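/- Let $n\ge 2$, let $K$ be a field, and let $L_n$ be the line (path) graph with vertices $1,\dots,n$ and edges $\{j,j+1\}$ for $1\le j\le n-1$. Let $S=K[x_1,\dots,x_n]$ and let $I(L_n)=(x_1x_2,x_2x_3,\dots,x_{n-1}x_n)\subset S$ be its edge ideal. Let $\operatorname{depth} L_n$ denote the depth of the $S$-module $S/I(L_n)$, that is, the supremum of the lengths of the $S/I(L_n)$-regular sequences in the graded maximal ideal $(x_1,\dots,x_n)$. Then $\operatorname{depth} L_n$ does not depend on the field $K$ (in particular not on its characteristic), and $$\operatorname{depth} L_n=\begin{cases} \frac{n}{3} & \text{if } n\equiv 0 \pmod 3,\\[1ex] \frac{n+2}{3} & \text{if } n\equiv 1 \pmod 3,\\[1ex] \frac{n+1}{3} & \text{if } n\equiv 2 \pmod 3.\end{cases}$$ -/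

import Mathlib

/-- The edge ideal `I(G)` of a graph `G` on the vertex set `V`, in the polynomial ring over `K`
with one variable for each vertex: it is generated by the monomials `x_i x_j`, for all edges
`{i, j}` of `G`. -/
noncomputable def edgeIdeal (K : Type*) [Field K] {V : Type*} (G : SimpleGraph V) :
    Ideal (MvPolynomial V K) :=
  Ideal.span {f | ∃ i j : V, G.Adj i j ∧ f = MvPolynomial.X i * MvPolynomial.X j}

/-- For an ideal `𝔞` of `R` and an `R`-module `M` with `𝔞 M ≠ M`, the supremum in `ℕ∞` of the
lengths of the `M`-regular sequences whose members all lie in `𝔞`. When `R` is local, or a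
standard graded algebra over a field, and `𝔞` is its (graded) maximal ideal, this is the depth of
the nonzero finitely generated (graded) module `M`. -/
noncomputable def depthAt {R : Type*} [CommRing R] (𝔞 : Ideal R) (M : Type*) [AddCommGroup M]
    [Module R M] : ℕ∞ :=
  sSup {d : ℕ∞ | ∃ rs : List R,
    (∀ r ∈ rs, r ∈ 𝔞) ∧ RingTheory.Sequence.IsRegular M rs ∧ d = (rs.length : ℕ∞)}

/-- The depth of a graph `G` over the field `K`: the depth of the `S`-module `S / I(G)` with respect
to the graded maximal ideal of `S`, generated by the variables, where `S = K[x_v : v ∈ V]`. -/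
noncomputable def graphDepth (K : Type*) [Field K] {V : Type*} (G : SimpleGraph V) : ℕ∞ :=
  depthAt (MvPolynomial.idealOfVars V K) (MvPolynomial V K ⧸ edgeIdeal K G)

/-!
Let `I` be the edge ideal of `G`. The depth of `S / I` is squeezed between two combinatorial bounds.

*Lower bound.* The sums of the variables over pairwise disjoint closed neighbourhoods form a regular
sequence. Indeed `0 → S / (J : x_c) → S / J → S / (J + (x_c)) → 0` is exact, a sequence weakly
regular on both ends is weakly regular in the middle, and when `J` is the edge ideal of a
vertex-deleted graph, so are both ends, with more vertices deleted: the neighbours of `c` on the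
left, `c` itself on the right. For suitable `c` one arrives at the case where each of the chosen
neighbourhoods contains an isolated vertex; its variable does not occur in the generators of `J`, so
each sum is monic in a variable of its own.

*Upper bound.* If `A` is an independent dominating set, the prime generated by the variables outside
`A` is `I : ∏ a ∈ A, x_a`, hence associated to `S / I`. Dividing out a regular element strictly
enlarges some associated prime, so a regular sequence has length at most `|V| - |Aᶜ| = |A|`.

The two bounds agree on a perfect code, and in a path every third vertex gives one.
-/

section ExactSequences

open RingTheory.Sequence

open scoped Pointwise

variable {R : Type*} [CommRing R]

section Modules

variable {M M' M'' : Type*} [AddCommGroup M] [Module R M] [AddCommGroup M'] [Module R M']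
  [AddCommGroup M''] [Module R M''] {f : M →ₗ[R] M'} {g : M' →ₗ[R] M''}

theorem quotSMulTop_map_injective (hf : Function.Injective f) (hfg : Function.Exact f g) {r : R}
    (hr : IsSMulRegular M'' r) : Function.Injective (QuotSMulTop.map r f) := by
  have hzero : Function.Exact (0 : M →ₗ[R] M) f := (LinearMap.exact_zero_iff_injective M f).2 hf
  have hexact := QuotSMulTop.map_first_exact_on_four_term_exact_of_isSMulRegular_last hzero hfg hr
  rw [map_zero] at hexact
  exact (LinearMap.exact_zero_iff_injective _ _).1 hexact

theorem isWeaklyRegular_of_exact (hf : Function.Injective f) (hfg : Function.Exact f g)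
    (hg : Function.Surjective g) {rs : List R} (h : IsWeaklyRegular M rs)
    (h'' : IsWeaklyRegular M'' rs) : IsWeaklyRegular M' rs := by
  induction rs generalizing M M' M'' with
  | nil => exact .nil R M'
  | cons r rs ih =>
    rw [isWeaklyRegular_cons_iff] at h h'' ⊢
    exact ⟨isSMulRegular_of_range_eq_ker hf hfg.linearMap_ker_eq.symm h.1 h''.1,
      ih (quotSMulTop_map_injective hf hfg h''.1) (QuotSMulTop.map_exact r hfg hg)
        (QuotSMulTop.map_surjective r hg) h.2 h''.2⟩

end Modules

variable {J : Ideal R}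

theorem isWeaklyRegular_quotient_of_colon_of_sup {c : R} {rs : List R}
    (hcolon : IsWeaklyRegular (R ⧸ J.colon {c}) rs)
    (hsup : IsWeaklyRegular (R ⧸ (J ⊔ Ideal.span {c})) rs) : IsWeaklyRegular (R ⧸ J) rs := by
  have hmem (a : R) : a ∈ J.colon {c} ↔ c * a ∈ J := by
    rw [Submodule.mem_colon_singleton, smul_eq_mul, mul_comm]
  let mulC : (R ⧸ J.colon {c}) →ₗ[R] R ⧸ J :=
    Submodule.mapQ (J.colon {c}) J (LinearMap.mulLeft R c) fun a ha => (hmem a).1 ha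
  let quot : (R ⧸ J) →ₗ[R] R ⧸ (J ⊔ Ideal.span {c}) := Submodule.factor le_sup_left
  have hinjective : Function.Injective mulC := by
    refine (injective_iff_map_eq_zero mulC).2 fun x hx => ?_
    obtain ⟨a, rfl⟩ := Submodule.Quotient.mk_surjective _ x
    exact (Submodule.Quotient.mk_eq_zero _).2
      ((hmem a).2 ((Submodule.Quotient.mk_eq_zero J).1 hx))
  have hexact : Function.Exact mulC quot := by
    intro x
    obtain ⟨a, rfl⟩ := Submodule.Quotient.mk_surjective _ x
    have hker : quot (Submodule.Quotient.mk a) = 0 ↔ a ∈ J ⊔ Ideal.span {c} :=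
      Submodule.Quotient.mk_eq_zero _
    rw [hker, sup_comm, Ideal.mem_span_singleton_sup]
    constructor
    · rintro ⟨b, j, hj, rfl⟩
      refine ⟨Submodule.Quotient.mk b, (Submodule.Quotient.eq J).2 ?_⟩
      simpa [mul_comm c b] using hj
    · rintro ⟨y, hy⟩
      obtain ⟨b, rfl⟩ := Submodule.Quotient.mk_surjective _ y
      have hsub : c * b - a ∈ J := (Submodule.Quotient.eq J).1 hy
      exact ⟨b, _, J.neg_mem hsub, by ring⟩
  exact isWeaklyRegular_of_exact hinjective hexact (Submodule.factor_surjective _) hcolon hsup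

theorem isWeaklyRegular_quotient_cons_iff {r : R} {rs : List R} :
    IsWeaklyRegular (R ⧸ J) (r :: rs) ↔
      IsSMulRegular (R ⧸ J) r ∧ IsWeaklyRegular (R ⧸ (J ⊔ Ideal.span {r})) rs := by
  have hmap : (r • ⊤ : Submodule R (R ⧸ J)) = Submodule.map J.mkQ (Ideal.span {r}) := by
    rw [← Submodule.range_mkQ J, ← Submodule.map_top, ← Submodule.map_pointwise_smul,
      ← Submodule.ideal_span_singleton_smul, smul_eq_mul, Ideal.mul_top]
  have e : QuotSMulTop r (R ⧸ J) ≃ₗ[R] R ⧸ (J ⊔ Ideal.span {r}) :=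
    Submodule.quotEquivOfEq _ _ hmap ≪≫ₗ Submodule.quotientQuotientEquivQuotientSup J _
  rw [isWeaklyRegular_cons_iff, e.isWeaklyRegular_congr]

end ExactSequences

section Depth

open RingTheory.Sequence

variable {R : Type*} [CommRing R] {𝔞 : Ideal R}

theorem length_le_depthAt {M : Type*} [AddCommGroup M] [Module R M]
    (h𝔞 : 𝔞 • (⊤ : Submodule R M) ≠ ⊤) {rs : List R} (hmem : ∀ r ∈ rs, r ∈ 𝔞)
    (hrs : IsWeaklyRegular M rs) : (rs.length : ℕ∞) ≤ depthAt 𝔞 M := by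
  have hle : Ideal.ofList rs ≤ 𝔞 := Ideal.span_le.2 hmem
  refine le_sSup ⟨rs, hmem, ⟨hrs, fun htop => h𝔞 ?_⟩, rfl⟩
  exact top_le_iff.1 (htop.trans_le (Submodule.smul_mono_left hle))

theorem smul_top_quotient_ne_top {I : Ideal R} (hI : I ≤ 𝔞) (h𝔞 : 𝔞 ≠ ⊤) :
    𝔞 • (⊤ : Submodule R (R ⧸ I)) ≠ ⊤ := by
  intro htop
  rw [← Submodule.range_mkQ I, ← Submodule.map_top, ← Submodule.map_smul'', smul_eq_mul,
    Ideal.mul_top, Submodule.map_top, Submodule.range_mkQ, Submodule.map_mkQ_eq_top,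
    sup_eq_right.2 hI] at htop
  exact h𝔞 htop

end Depth

section AssociatedPrimes

open RingTheory.Sequence

variable {R : Type*} [CommRing R] {M : Type*} [AddCommGroup M] [Module R M] {p 𝔪 : Ideal R}
  {x : R}

theorem isSMulRegular_quotient_torsionBySet (hx : IsSMulRegular M x) (s : Set R) :
    IsSMulRegular (M ⧸ Submodule.torsionBySet R M s) x := by
  rw [isSMulRegular_quotient_iff_mem_of_smul_mem]
  intro m hm
  rw [Submodule.mem_torsionBySet_iff] at hm ⊢
  intro a
  refine hx.right_eq_zero_of_smul ?_
  rw [smul_comm, hm a]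

variable [IsNoetherianRing R]

theorem isAssociatedPrime_quotient_of_colon_eq {I : Ideal R} [p.IsPrime] {y : R}
    (h : I.colon {y} = p) : IsAssociatedPrime p (R ⧸ I) := by
  refine isAssociatedPrime_iff.2 ⟨‹_›, Submodule.Quotient.mk y, ?_⟩
  ext a
  rw [← h, Submodule.mem_colon_singleton, Submodule.mem_colon_singleton,
    ← Submodule.Quotient.mk_smul, Submodule.mem_bot, Submodule.Quotient.mk_eq_zero]

theorem annihilator_torsionBySet_of_isAssociatedPrime (hp : IsAssociatedPrime p M) :
    Module.annihilator R (Submodule.torsionBySet R M (p : Set R)) = p := by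
  obtain ⟨-, m, hm⟩ := isAssociatedPrime_iff.1 hp
  refine le_antisymm (fun a ha => ?_) fun a ha => Module.mem_annihilator.2 fun y => ?_
  · have hmN : m ∈ Submodule.torsionBySet R M (p : Set R) :=
      (Submodule.mem_torsionBySet_iff _ _).2 fun b => by
        simpa [hm, Submodule.mem_colon_singleton] using b.2
    rw [hm, Submodule.mem_colon_singleton, Submodule.mem_bot]
    exact congrArg Subtype.val (Module.mem_annihilator.1 ha ⟨m, hmN⟩)
  · exact Submodule.torsionBySet_isTorsionBySet (p : Set R) (a := ⟨a, ha⟩)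

variable [Module.Finite R M]

theorem exists_associatedPrime_quotSMulTop [𝔪.IsPrime] (hp : IsAssociatedPrime p M) (hpm : p ≤ 𝔪)
    (hxm : x ∈ 𝔪) (hx : IsSMulRegular M x) :
    ∃ q, IsAssociatedPrime q (QuotSMulTop x M) ∧ p < q ∧ q ≤ 𝔪 := by
  -- The support of `N / xN` is `V(p) ∩ V(x)`, and `N / xN` embeds in `M / xM`.
  let N := Submodule.torsionBySet R M (p : Set R)
  have hannN : Module.annihilator R N = p := annihilator_torsionBySet_of_isAssociatedPrime hp
  have hinj : Function.Injective (QuotSMulTop.map x N.subtype) :=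
    quotSMulTop_map_injective N.injective_subtype (LinearMap.exact_subtype_mkQ N)
      (isSMulRegular_quotient_torsionBySet hx _)
  have hsupport : (⟨𝔪, ‹_›⟩ : PrimeSpectrum R) ∈ Module.support R (QuotSMulTop x N) := by
    rw [Module.support_quotSMulTop]
    refine ⟨Module.mem_support_iff_of_finite.2 (hannN.trans_le hpm), ?_⟩
    simpa [PrimeSpectrum.mem_zeroLocus] using hxm
  obtain ⟨q, hq, hqm⟩ :=
    Ideal.exists_minimalPrimes_le (Module.annihilator_le_of_mem_support hsupport)
  have hqass : IsAssociatedPrime q (QuotSMulTop x N) :=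
    Module.associatedPrimes.minimalPrimes_annihilator_subset_associatedPrimes R _ hq
  have hpq : p ≤ q := hannN.symm.trans_le <|
    ((Submodule.mkQ _).annihilator_le_of_surjective (Submodule.mkQ_surjective _)).trans hq.1.2
  have hxp : x ∉ p := fun h => by
    obtain ⟨hprime, m, hm⟩ := isAssociatedPrime_iff.1 hp
    rw [hm, Submodule.mem_colon_singleton, Submodule.mem_bot] at h
    refine hprime.ne_top ((Ideal.eq_top_iff_one _).2 ?_)
    simp [hm, Submodule.mem_colon_singleton, hx.right_eq_zero_of_smul h]
  refine ⟨q, hqass.map_of_injective _ hinj, lt_of_le_of_ne hpq ?_, hqm⟩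
  rintro rfl
  exact hxp (hq.1.2 (QuotSMulTop.mem_annihilator _ x))

theorem height_add_length_le [𝔪.IsPrime] (hp : IsAssociatedPrime p M) (hpm : p ≤ 𝔪) {rs : List R}
    (hrs : ∀ r ∈ rs, r ∈ 𝔪) (hreg : IsWeaklyRegular M rs) :
    p.height + rs.length ≤ 𝔪.height := by
  induction rs generalizing M p with
  | nil => simpa using Ideal.height_mono hpm
  | cons r rs ih =>
    rw [isWeaklyRegular_cons_iff] at hreg
    rw [List.forall_mem_cons] at hrs
    obtain ⟨q, hq, hpq, hqm⟩ := exists_associatedPrime_quotSMulTop hp hpm hrs.1 hreg.1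
    have := hp.isPrime
    have := hq.isPrime
    calc p.height + (r :: rs).length = p.height + 1 + rs.length := by
          rw [List.length_cons, Nat.cast_add_one, add_comm (rs.length : ℕ∞), add_assoc]
      _ ≤ q.height + rs.length := by gcongr; exact Ideal.height_add_one_le_of_lt_of_isPrime hpq
      _ ≤ 𝔪.height := ih hq hqm hrs.2 hreg.2

end AssociatedPrimes

section Variables

open MvPolynomial RingTheory.Sequence

theorem isSMulRegular_quotient_map_C {A : Type*} [CommRing A] (J : Ideal A) {p : Polynomial A}
    (hp : p.Monic) : IsSMulRegular (Polynomial A ⧸ J.map Polynomial.C) p := by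
  rw [isSMulRegular_quotient_iff_mem_of_smul_mem, ← Ideal.mk_ker (I := J),
    ← Polynomial.ker_mapRingHom]
  intro f hf
  rw [smul_eq_mul, RingHom.mem_ker, map_mul] at hf
  exact (hp.map _).isRegular.left.mul_left_eq_zero_iff.1 hf

variable {R V : Type*} [CommRing R]

section Regular

variable {s : Set (MvPolynomial V R)} {v : V}

variable (R) in
open Classical in
/-- Polynomials in the variables `x_w` viewed as polynomials in the single variable `x_v`, with
coefficients in the polynomial ring in the variables `x_w` for `w ≠ v`. -/
noncomputable def isolateVar (v : V) :
    MvPolynomial V R ≃ₐ[R] Polynomial (MvPolynomial {w // w ≠ v} R) :=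
  (renameEquiv R (Equiv.optionSubtypeNe v).symm).trans (optionEquivLeft R _)

theorem isolateVar_X_self : isolateVar R v (X v) = Polynomial.X := by
  classical
  simp [isolateVar, optionEquivLeft_X_none]

theorem isolateVar_X_of_ne {w : V} (hw : w ≠ v) :
    isolateVar R v (X w) = Polynomial.C (X ⟨w, hw⟩) := by
  classical
  simp [isolateVar, Equiv.optionSubtypeNe_symm_of_ne hw, optionEquivLeft_X_some]

theorem isolateVar_mem_range_C {f : MvPolynomial V R} (hf : f ∈ supported R {v}ᶜ) :
    isolateVar R v f ∈ Set.range Polynomial.C := by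
  have hle : supported R {v}ᶜ ≤ (Polynomial.CAlgHom (R := R)).range.comap
      (isolateVar R v : MvPolynomial V R →ₐ[R] Polynomial (MvPolynomial {w // w ≠ v} R)) := by
    refine Algebra.adjoin_le ?_
    rintro _ ⟨w, hw, rfl⟩
    exact ⟨_, (isolateVar_X_of_ne hw).symm⟩
  exact hle hf

theorem isSMulRegular_quotient_span_of_sub_X_mem_supported (hs : s ⊆ supported R {v}ᶜ)
    {p : MvPolynomial V R} (hp : p - X v ∈ supported R {v}ᶜ) :
    IsSMulRegular (MvPolynomial V R ⧸ Ideal.span s) p := by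
  let e := isolateVar R v
  have hmonic : (e p).Monic := by
    obtain ⟨g, hg⟩ := isolateVar_mem_range_C hp
    have hep : e p = Polynomial.X + Polynomial.C g := by
      rw [hg, map_sub, isolateVar_X_self, add_sub_cancel]
    exact hep ▸ Polynomial.monic_X_add_C g
  have hspan : (Ideal.span s).map e =
      (Ideal.span (Polynomial.C ⁻¹' (e '' s))).map Polynomial.C := by
    rw [Ideal.map_span, Ideal.map_span, Set.image_preimage_eq_of_subset]
    rintro _ ⟨f, hf, rfl⟩
    exact isolateVar_mem_range_C (hs hf)
  have hmem (f : MvPolynomial V R) : e f ∈ (Ideal.span s).map e ↔ f ∈ Ideal.span s := by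
    rw [← Ideal.mem_comap, Ideal.comap_map_of_bijective e e.bijective]
  rw [isSMulRegular_quotient_iff_mem_of_smul_mem]
  intro f hf
  rw [← hmem, hspan] at hf ⊢
  rw [smul_eq_mul, map_mul] at hf
  exact mem_of_isSMulRegular_quotient_of_smul_mem (isSMulRegular_quotient_map_C _ hmonic) hf

theorem isWeaklyRegular_quotient_span_of_sub_X_mem_supported {ι : Type*} {L : List ι} {v : ι → V}
    {p : ι → MvPolynomial V R} (hs : ∀ i ∈ L, s ⊆ supported R {v i}ᶜ)
    (hp : ∀ i ∈ L, p i - X (v i) ∈ supported R {v i}ᶜ)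
    (hL : L.Pairwise fun i j => p i ∈ supported R {v j}ᶜ) :
    IsWeaklyRegular (MvPolynomial V R ⧸ Ideal.span s) (L.map p) := by
  induction L generalizing s with
  | nil => exact .nil _ _
  | cons i L ih =>
    rw [List.pairwise_cons] at hL
    rw [List.forall_mem_cons] at hs hp
    rw [List.map_cons, isWeaklyRegular_quotient_cons_iff, ← Ideal.span_union]
    exact ⟨isSMulRegular_quotient_span_of_sub_X_mem_supported hs.1 hp.1,
      ih (fun j hj => Set.union_subset (hs.2 j hj) (Set.singleton_subset_iff.2 (hL.1 j hj)))
        hp.2 hL.2⟩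

end Regular

section Prime

variable [IsDomain R]

theorem isPrime_span_X_image (D : Set V) :
    (Ideal.span (X '' D : Set (MvPolynomial V R))).IsPrime := by
  classical
  let P : Ideal (MvPolynomial V R) := Ideal.span (X '' D)
  let φ : MvPolynomial V R →ₐ[R] MvPolynomial V R := aeval fun v => if v ∈ D then 0 else X v
  have hmk : (Ideal.Quotient.mkₐ R P).comp φ = Ideal.Quotient.mkₐ R P := by
    ext v
    by_cases hv : v ∈ D
    · have hXv : Ideal.Quotient.mk P (X v) = 0 :=
        Ideal.Quotient.eq_zero_iff_mem.2 (Ideal.subset_span ⟨v, hv, rfl⟩)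
      simp [φ, hv, hXv]
    · simp [φ, hv]
  have hker : P = RingHom.ker φ := by
    refine le_antisymm (Ideal.span_le.2 ?_) fun f hf => ?_
    · rintro _ ⟨v, hv, rfl⟩
      simp [φ, hv]
    · rw [RingHom.mem_ker] at hf
      refine Ideal.Quotient.eq_zero_iff_mem.1 (?_ : Ideal.Quotient.mkₐ R P f = 0)
      rw [← hmk, AlgHom.comp_apply, hf, map_zero]
  change P.IsPrime
  exact hker ▸ RingHom.ker_isPrime φ

theorem span_X_image_lt_span_X_image {D D' : Set V} (h : D ⊂ D') :
    (Ideal.span (X '' D) : Ideal (MvPolynomial V R)) < Ideal.span (X '' D') := by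
  obtain ⟨hle, v, hv, hvD⟩ := Set.ssubset_iff_exists.1 h
  refine SetLike.lt_iff_le_and_exists.2 ⟨Ideal.span_mono (Set.image_mono hle), X v,
    Ideal.subset_span ⟨v, hv, rfl⟩, fun hmem => ?_⟩
  obtain ⟨w, hwD, hw⟩ := mem_ideal_span_X_image.1 hmem (Finsupp.single v 1) (by simp [support_X])
  exact hvD ((Finsupp.single_apply_ne_zero.1 hw).1 ▸ hwD)

theorem card_le_height_span_X_image (D : Finset V) :
    (D.card : ℕ∞) ≤ (Ideal.span (X '' (D : Set V) : Set (MvPolynomial V R))).height := by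
  classical
  induction D using Finset.induction with
  | empty => simp
  | insert v D hv ih =>
    have := isPrime_span_X_image (R := R) (D : Set V)
    have := isPrime_span_X_image (R := R) (↑(insert v D) : Set V)
    have hlt := span_X_image_lt_span_X_image (R := R)
      (Finset.coe_ssubset.2 (Finset.ssubset_insert hv))
    rw [Finset.card_insert_of_notMem hv, Nat.cast_add_one]
    exact (add_le_add_left ih 1).trans (Ideal.height_add_one_le_of_lt_of_isPrime hlt)

theorem isPrime_idealOfVars : (idealOfVars V R).IsPrime := by
  rw [idealOfVars, ← Set.image_univ]
  exact isPrime_span_X_image Set.univ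

theorem height_idealOfVars_le [IsNoetherianRing R] [Finite V] :
    (idealOfVars V R).height ≤ Nat.card V := by
  refine (Ideal.height_le_spanFinrank _ isPrime_idealOfVars.ne_top).trans ?_
  rw [← Set.ncard_univ, idealOfVars, ← Set.image_univ]
  exact_mod_cast (Submodule.spanFinrank_span_le_ncard_of_finite (Set.toFinite _)).trans
    (Set.ncard_image_le (Set.toFinite _))

end Prime

end Variables

section EdgeIdeal

open MvPolynomial

variable (K : Type*) [Field K] {V : Type*} (G : SimpleGraph V)

/-- The ideal of `S` whose quotient is `S' / I(G - D)`, where `S'` is the polynomial ring in the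
variables outside `D`: the vertices in `D` are deleted from `G` by killing their variables. -/
noncomputable def edgeIdealDelete (D : Set V) : Ideal (MvPolynomial V K) :=
  edgeIdeal K G ⊔ Ideal.span (X '' D)

/-- The vertex `v` is an isolated vertex of the graph `G - D`. -/
def IsIsolatedOff (D : Set V) (v : V) : Prop :=
  v ∉ D ∧ G.neighborSet v ⊆ D

variable {K G} {D : Set V} {c : V}

theorem edgeIdealDelete_empty : edgeIdealDelete K G ∅ = edgeIdeal K G := by
  simp [edgeIdealDelete]

theorem edgeIdealDelete_mono {D' : Set V} (h : D ⊆ D') :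
    edgeIdealDelete K G D ≤ edgeIdealDelete K G D' :=
  sup_le_sup_left (Ideal.span_mono (Set.image_mono h)) _

theorem edgeIdealDelete_sup_span_X :
    edgeIdealDelete K G D ⊔ Ideal.span {X c} = edgeIdealDelete K G (insert c D) := by
  rw [edgeIdealDelete, edgeIdealDelete, sup_assoc, ← Ideal.span_union, Set.image_insert_eq,
    Set.union_singleton]

theorem X_mem_edgeIdealDelete {v : V} (hv : v ∈ D) : X v ∈ edgeIdealDelete K G D :=
  le_sup_right (a := edgeIdeal K G) (Ideal.subset_span ⟨v, hv, rfl⟩)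

theorem X_mul_X_mem_edgeIdealDelete {v w : V} (h : G.Adj v w) :
    X v * X w ∈ edgeIdealDelete K G D :=
  le_sup_left (a := edgeIdeal K G) (Ideal.subset_span ⟨v, w, h, rfl⟩)

theorem edgeIdealDelete_eq_span : edgeIdealDelete K G D = Ideal.span
    (X '' D ∪ {f | ∃ v ∉ D, ∃ w ∉ D, G.Adj v w ∧ f = X v * X w}) := by
  refine le_antisymm (sup_le (Ideal.span_le.2 ?_) (Ideal.span_mono Set.subset_union_left))
    (Ideal.span_le.2 (Set.union_subset ?_ ?_))
  · rintro _ ⟨v, w, hvw, rfl⟩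
    by_cases hv : v ∈ D
    · exact Ideal.mul_mem_right _ _ (Ideal.subset_span (.inl ⟨v, hv, rfl⟩))
    by_cases hw : w ∈ D
    · exact Ideal.mul_mem_left _ _ (Ideal.subset_span (.inl ⟨w, hw, rfl⟩))
    exact Ideal.subset_span (.inr ⟨v, hv, w, hw, hvw, rfl⟩)
  · rintro _ ⟨v, hv, rfl⟩
    exact X_mem_edgeIdealDelete hv
  · rintro _ ⟨v, -, w, -, hvw, rfl⟩
    exact X_mul_X_mem_edgeIdealDelete hvw

theorem IsIsolatedOff.generators_subset_supported {u : V} (hu : IsIsolatedOff G D u) :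
    X '' D ∪ {f | ∃ v ∉ D, ∃ w ∉ D, G.Adj v w ∧ f = X v * X w} ⊆
      (supported K {u}ᶜ : Set (MvPolynomial V K)) := by
  have hX {v : V} (hv : v ≠ u) : X v ∈ supported K {u}ᶜ := X_mem_supported.2 hv
  refine Set.union_subset ?_ ?_
  · rintro _ ⟨v, hv, rfl⟩
    exact hX (ne_of_mem_of_not_mem hv hu.1)
  · rintro _ ⟨v, hv, w, hw, hvw, rfl⟩
    refine mul_mem (hX ?_) (hX ?_)
    · rintro rfl
      exact hw (hu.2 hvw)
    · rintro rfl
      exact hv (hu.2 hvw.symm)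

theorem IsIsolatedOff.isSMulRegular_X {v : V} (hv : IsIsolatedOff G D v) :
    IsSMulRegular (MvPolynomial V K ⧸ edgeIdealDelete K G D) (X v : MvPolynomial V K) := by
  rw [edgeIdealDelete_eq_span]
  exact isSMulRegular_quotient_span_of_sub_X_mem_supported hv.generators_subset_supported
    (by rw [sub_self]; exact zero_mem _)

theorem isIsolatedOff_union_neighborSet (hc : c ∉ D) : IsIsolatedOff G (D ∪ G.neighborSet c) c :=
  ⟨by simpa using hc, Set.subset_union_right⟩

theorem edgeIdealDelete_colon_X (hc : c ∉ D) :
    (edgeIdealDelete K G D).colon {X c} = edgeIdealDelete K G (D ∪ G.neighborSet c) := by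
  refine le_antisymm (fun f hf => ?_) (sup_le ?_ (Ideal.span_le.2 ?_))
  · rw [Submodule.mem_colon_singleton, smul_eq_mul, mul_comm] at hf
    exact mem_of_isSMulRegular_quotient_of_smul_mem
      (isIsolatedOff_union_neighborSet hc).isSMulRegular_X
      (edgeIdealDelete_mono Set.subset_union_left hf)
  · exact le_sup_left.trans Ideal.le_colon
  · rintro _ ⟨v, hv, rfl⟩
    rw [SetLike.mem_coe, Submodule.mem_colon_singleton, smul_eq_mul]
    rcases hv with hv | hv
    · exact Ideal.mul_mem_right _ _ (X_mem_edgeIdealDelete hv)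
    · exact X_mul_X_mem_edgeIdealDelete (G.adj_symm hv)

theorem edgeIdealDelete_colon_prod_X {A : Finset V} (hA : G.IsIndepSet A)
    (hAD : Disjoint (A : Set V) D) : (edgeIdealDelete K G D).colon {∏ a ∈ A, X a} =
      edgeIdealDelete K G (D ∪ ⋃ a ∈ A, G.neighborSet a) := by
  classical
  induction A using Finset.induction generalizing D with
  | empty =>
    ext f
    simp [Submodule.mem_colon_singleton]
  | insert a A ha ih =>
    rw [Finset.coe_insert, Set.disjoint_insert_left] at hAD
    rw [Finset.coe_insert, SimpleGraph.IsIndepSet,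
      Set.pairwise_insert_of_notMem (Finset.mem_coe.not.2 ha)] at hA
    have hdisj : Disjoint (A : Set V) (D ∪ G.neighborSet a) :=
      hAD.2.union_right (Set.disjoint_left.2 fun b hb => (hA.2 b hb).1)
    have hunion : D ∪ ⋃ b ∈ insert a A, G.neighborSet b =
        D ∪ G.neighborSet a ∪ ⋃ b ∈ A, G.neighborSet b := by
      rw [Finset.set_biUnion_insert, Set.union_assoc]
    rw [hunion, ← ih hA.1 hdisj, ← edgeIdealDelete_colon_X hAD.1, Finset.prod_insert ha]
    ext f
    simp only [Submodule.mem_colon_singleton, smul_eq_mul, mul_assoc, mul_comm (X a)]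

theorem edgeIdealDelete_compl {A : Set V} (hA : G.IsIndepSet A) :
    edgeIdealDelete K G Aᶜ = Ideal.span (X '' Aᶜ) := by
  rw [edgeIdealDelete_eq_span]
  congr 1
  refine Set.union_eq_left.2 ?_
  rintro _ ⟨v, hv, w, hw, hvw, rfl⟩
  exact absurd hvw (hA (Set.notMem_compl_iff.1 hv) (Set.notMem_compl_iff.1 hw) hvw.ne)

theorem edgeIdeal_le_idealOfVars : edgeIdeal K G ≤ idealOfVars V K := by
  refine Ideal.span_le.2 ?_
  rintro _ ⟨v, w, -, rfl⟩
  exact Ideal.mul_mem_left _ _ (Ideal.subset_span ⟨w, rfl⟩)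

end EdgeIdeal

section Packing

open MvPolynomial RingTheory.Sequence

variable {V : Type*} (G : SimpleGraph V) [DecidableEq V] [G.LocallyFinite]

/-- The closed neighbourhood `N[v]` of `v`: the vertex `v` together with its neighbours. -/
def closedNeighborFinset (v : V) : Finset V :=
  insert v (G.neighborFinset v)

variable {G}

theorem mem_closedNeighborFinset {v w : V} :
    w ∈ closedNeighborFinset G v ↔ w = v ∨ G.Adj v w := by
  simp [closedNeighborFinset]

variable (G) in
/-- The condition on `b` under which deleting `D` from `G` keeps the sum of the variables in `N[b]`
regular: either `b` itself survives, or some vertex of `N[b]` survives as an isolated vertex. -/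
def SurvivesDeletion (D : Set V) (b : V) : Prop :=
  b ∉ D ∨ ∃ v ∈ closedNeighborFinset G b, IsIsolatedOff G D v

variable {D : Set V} {b c : V}

theorem SurvivesDeletion.union_neighborSet (hb : SurvivesDeletion G D b) (hc : c ∉ D) :
    SurvivesDeletion G (D ∪ G.neighborSet c) b := by
  rcases hb with hb | ⟨v, hvb, hvD, hv⟩
  · by_cases hcb : G.Adj c b
    · exact .inr ⟨c, mem_closedNeighborFinset.2 (.inr hcb.symm),
        isIsolatedOff_union_neighborSet hc⟩
    · exact .inl fun h => h.elim hb hcb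
  · exact .inr ⟨v, hvb, fun h => h.elim hvD fun hcv => hc (hv hcv.symm),
      hv.trans Set.subset_union_left⟩

theorem SurvivesDeletion.insert (hb : SurvivesDeletion G D b)
    (hc : c ∉ closedNeighborFinset G b) : SurvivesDeletion G (insert c D) b := by
  rcases hb with hb | ⟨v, hvb, hvD, hv⟩
  · have hbc : b ≠ c := fun h => hc (mem_closedNeighborFinset.2 (.inl h.symm))
    exact .inl fun h => h.elim hbc hb
  · exact .inr ⟨v, hvb, fun h => h.elim (ne_of_mem_of_not_mem hvb hc) hvD,
      hv.trans (Set.subset_insert c D)⟩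

theorem SurvivesDeletion.notMem_and_exists_adj (hb : SurvivesDeletion G D b)
    (hD : ∀ v ∈ closedNeighborFinset G b, ¬IsIsolatedOff G D v) :
    b ∉ D ∧ ∃ c, G.Adj b c ∧ c ∉ D := by
  have hbD : b ∉ D := hb.resolve_right fun ⟨v, hvb, hv⟩ => hD v hvb hv
  exact ⟨hbD, Set.not_subset.1 fun h => hD b (mem_closedNeighborFinset.2 (.inl rfl)) ⟨hbD, h⟩⟩

variable {K : Type*} [Field K] {L : List V}

theorem isWeaklyRegular_quotient_edgeIdealDelete_of_isIsolatedOff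
    (hL : L.Pairwise (Function.onFun Disjoint (closedNeighborFinset G)))
    (hisolated : ∀ b ∈ L, ∃ v ∈ closedNeighborFinset G b, IsIsolatedOff G D v) :
    IsWeaklyRegular (MvPolynomial V K ⧸ edgeIdealDelete K G D)
      (L.map fun b => ∑ w ∈ closedNeighborFinset G b, (X w : MvPolynomial V K)) := by
  choose! v hvb hv using hisolated
  have hsum {s : Finset V} {u : V} (hu : u ∉ s) :
      ∑ w ∈ s, (X w : MvPolynomial V K) ∈ supported K {u}ᶜ :=
    sum_mem fun w hw => X_mem_supported.2 (ne_of_mem_of_not_mem hw hu)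
  rw [edgeIdealDelete_eq_span]
  refine isWeaklyRegular_quotient_span_of_sub_X_mem_supported (v := v)
    (fun b hb => (hv b hb).generators_subset_supported) (fun b hb => ?_) ?_
  · rw [← Finset.sum_erase_eq_sub (hvb b hb)]
    exact hsum (Finset.notMem_erase _ _)
  · refine hL.imp_of_mem fun {a b} _ hb hab => hsum ?_
    exact Finset.disjoint_right.1 hab (hvb b hb)

theorem isWeaklyRegular_quotient_edgeIdealDelete
    (hL : L.Pairwise (Function.onFun Disjoint (closedNeighborFinset G)))
    (hsurvive : ∀ b ∈ L, SurvivesDeletion G D b) :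
    IsWeaklyRegular (MvPolynomial V K ⧸ edgeIdealDelete K G D)
      (L.map fun b => ∑ w ∈ closedNeighborFinset G b, (X w : MvPolynomial V K)) := by
  classical
  let U : Finset V := L.toFinset.biUnion (closedNeighborFinset G)
  -- Only the vertices in the chosen neighbourhoods matter, so `V` itself may be infinite.
  induction hn : (U.filter (· ∉ D)).card using Nat.strong_induction_on generalizing D with
  | _ n ih
  by_cases hisolated : ∀ b ∈ L, ∃ v ∈ closedNeighborFinset G b, IsIsolatedOff G D v
  · exact isWeaklyRegular_quotient_edgeIdealDelete_of_isIsolatedOff hL hisolated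
  push Not at hisolated
  obtain ⟨b, hbL, hb⟩ := hisolated
  obtain ⟨hbD, c, hbc, hcD⟩ := (hsurvive b hbL).notMem_and_exists_adj hb
  have hbb : b ∈ closedNeighborFinset G b := mem_closedNeighborFinset.2 (.inl rfl)
  have hcb : c ∈ closedNeighborFinset G b := mem_closedNeighborFinset.2 (.inr hbc)
  have hdecrease {D' : Set V} {u : V} (hD : D ⊆ D') (hub : u ∈ closedNeighborFinset G b)
      (huD : u ∉ D) (huD' : u ∈ D') : (U.filter (· ∉ D')).card < n := by
    have hu : u ∈ U := Finset.mem_biUnion.2 ⟨b, List.mem_toFinset.2 hbL, hub⟩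
    rw [← hn]
    refine Finset.card_lt_card (Finset.ssubset_iff_of_subset ?_ |>.2 ⟨u, ?_, ?_⟩)
    · exact Finset.monotone_filter_right U fun w _ hw hwD => hw (hD hwD)
    · simp [hu, huD]
    · simp [huD']
  refine isWeaklyRegular_quotient_of_colon_of_sup (c := X c) ?_ ?_
  · rw [edgeIdealDelete_colon_X hcD]
    exact ih _ (hdecrease Set.subset_union_left hbb hbD (.inr hbc.symm))
      (fun a ha => (hsurvive a ha).union_neighborSet hcD) rfl
  · rw [edgeIdealDelete_sup_span_X]
    refine ih _ (hdecrease (Set.subset_insert c D) hcb hcD (.inl rfl)) (fun a ha => ?_) rfl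
    by_cases hab : a = b
    · exact .inl fun h => h.elim (fun h => hbc.ne (hab ▸ h)) (hab ▸ hbD)
    · refine (hsurvive a ha).insert fun hca => ?_
      exact Finset.disjoint_left.1 (hL.forall ha hbL hab) hca hcb

theorem card_le_graphDepth {A : Finset V}
    (hA : (A : Set V).PairwiseDisjoint (closedNeighborFinset G)) :
    (A.card : ℕ∞) ≤ graphDepth K G := by
  have hL : A.toList.Pairwise (Function.onFun Disjoint (closedNeighborFinset G)) :=
    A.nodup_toList.imp_of_mem fun {a b} ha hb hab =>
      hA (Finset.mem_toList.1 ha) (Finset.mem_toList.1 hb) hab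
  have hreg := isWeaklyRegular_quotient_edgeIdealDelete (K := K) (D := ∅) hL
    fun b _ => .inl (Set.notMem_empty b)
  rw [edgeIdealDelete_empty] at hreg
  have htop := smul_top_quotient_ne_top (edgeIdeal_le_idealOfVars (K := K) (G := G))
    isPrime_idealOfVars.ne_top
  have hmem (b : V) : ∑ w ∈ closedNeighborFinset G b, (X w : MvPolynomial V K) ∈ idealOfVars V K :=
    sum_mem fun w _ => Ideal.subset_span (Set.mem_range_self w)
  have hlength := length_le_depthAt htop (List.forall_mem_map.2 fun b _ => hmem b) hreg
  rwa [List.length_map, Finset.length_toList] at hlength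

end Packing

section Domination

open MvPolynomial

variable {K : Type*} [Field K] {V : Type*} {G : SimpleGraph V}

theorem isAssociatedPrime_span_X_compl [Finite V] {A : Finset V} (hA : G.IsIndepSet A)
    (hdom : ∀ v ∉ A, ∃ a ∈ A, G.Adj a v) :
    IsAssociatedPrime (Ideal.span (X '' (A : Set V)ᶜ) : Ideal (MvPolynomial V K))
      (MvPolynomial V K ⧸ edgeIdeal K G) := by
  have := isPrime_span_X_image (R := K) (A : Set V)ᶜ
  have hneighbors : ⋃ a ∈ A, G.neighborSet a = (A : Set V)ᶜ := by
    ext v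
    simp only [Set.mem_iUnion₂, SimpleGraph.mem_neighborSet, exists_prop, Set.mem_compl_iff,
      Finset.mem_coe]
    refine ⟨?_, hdom v⟩
    rintro ⟨a, ha, hav⟩ hv
    exact hA ha hv hav.ne hav
  refine isAssociatedPrime_quotient_of_colon_eq (y := ∏ a ∈ A, X a) ?_
  rw [← edgeIdealDelete_empty, edgeIdealDelete_colon_prod_X hA (Set.disjoint_empty _),
    Set.empty_union, hneighbors, edgeIdealDelete_compl hA]

theorem graphDepth_le_card [Finite V] {A : Finset V} (hA : G.IsIndepSet A)
    (hdom : ∀ v ∉ A, ∃ a ∈ A, G.Adj a v) : graphDepth K G ≤ A.card := by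
  classical
  have := Fintype.ofFinite V
  refine sSup_le ?_
  rintro _ ⟨rs, hrs, hreg, rfl⟩
  have := isPrime_idealOfVars (R := K) (V := V)
  have hle := height_add_length_le (isAssociatedPrime_span_X_compl (K := K) hA hdom)
    (Ideal.span_mono (Set.image_subset_range _ _)) hrs hreg.toIsWeaklyRegular
  have hcompl : (Aᶜ.card : ℕ∞) ≤
      (Ideal.span (X '' (A : Set V)ᶜ : Set (MvPolynomial V K))).height := by
    rw [← Finset.coe_compl]
    exact card_le_height_span_X_image Aᶜ
  have hcard : (Aᶜ.card : ℕ∞) + rs.length ≤ Nat.card V :=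
    (add_le_add_left hcompl _).trans (hle.trans height_idealOfVars_le)
  rw [Nat.card_eq_fintype_card, ← Finset.card_compl_add_card A] at hcard
  norm_cast at hcard ⊢
  omega

end Domination

section PerfectCode

variable (K : Type*) [Field K] {V : Type*} {G : SimpleGraph V}

/-- A perfect code (or efficient dominating set) of `G`: a set of vertices whose closed
neighbourhoods partition the vertex set. -/
def IsPerfectCode (G : SimpleGraph V) (A : Set V) : Prop :=
  ∀ v, ∃! a, a ∈ A ∧ (v = a ∨ G.Adj a v)

theorem IsPerfectCode.graphDepth_eq_card [Finite V] {A : Finset V} (hA : IsPerfectCode G A) :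
    graphDepth K G = A.card := by
  classical
  have := Fintype.ofFinite V
  refine le_antisymm (graphDepth_le_card (fun a ha b hb hne hab => hne ?_) fun v hv => ?_)
    (card_le_graphDepth fun a ha b hb hne => Finset.disjoint_left.2 fun v hva hvb => hne ?_)
  · exact (hA b).unique ⟨ha, .inr hab⟩ ⟨hb, .inl rfl⟩
  · obtain ⟨a, ⟨ha, hva⟩, -⟩ := hA v
    exact ⟨a, ha, hva.resolve_left fun h => hv (h ▸ ha)⟩
  · exact (hA v).unique ⟨ha, mem_closedNeighborFinset.1 hva⟩ ⟨hb, mem_closedNeighborFinset.1 hvb⟩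

end PerfectCode

section Path

open SimpleGraph

theorem isPerfectCode_pathGraph {n ε : ℕ} (hε : n % 3 = 1 ∧ ε = 0 ∨ n % 3 ≠ 1 ∧ ε = 1) :
    IsPerfectCode (pathGraph n) {v : Fin n | v.val % 3 = ε} := by
  intro v
  have hv := v.isLt
  have hexists : ∃ a : Fin n, a.val % 3 = ε ∧ (v = a ∨ (pathGraph n).Adj a v) := by
    simp only [pathGraph_adj, Fin.ext_iff]
    obtain h | h | h : v.val % 3 = ε ∨ v.val % 3 = ε + 1 ∨ (v.val + 1) % 3 = ε := by omega
    · exact ⟨v, h, .inl rfl⟩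
    · exact ⟨⟨v - 1, by omega⟩, by simp only; omega, .inr (.inl (by simp only; omega))⟩
    · exact ⟨⟨v + 1, by omega⟩, h, .inr (.inr rfl)⟩
  refine existsUnique_of_exists_of_unique hexists ?_
  rintro a b ⟨ha, hav⟩ ⟨hb, hbv⟩
  simp only [Set.mem_ofPred_eq, pathGraph_adj, Fin.ext_iff] at ha hav hb hbv ⊢
  omega

theorem card_filter_val_mod_three {n ε : ℕ} (hε : n % 3 = 1 ∧ ε = 0 ∨ n % 3 ≠ 1 ∧ ε = 1) :
    (Finset.univ.filter fun v : Fin n => v.val % 3 = ε).card = (n + 2) / 3 := by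
  refine (Finset.card_bij (s := Finset.range ((n + 2) / 3))
    (fun i hi => ⟨3 * i + ε, by rw [Finset.mem_range] at hi; omega⟩) ?_ ?_ ?_).symm.trans
    (Finset.card_range _)
  · intro i hi
    simp only [Finset.mem_filter_univ]
    omega
  · intro i _ j _ hij
    rw [Fin.mk.injEq] at hij
    omega
  · intro v hv
    rw [Finset.mem_filter_univ] at hv
    exact ⟨v / 3, Finset.mem_range.2 (by omega), Fin.ext (by simp only; omega)⟩

theorem graphDepth_pathGraph (K : Type*) [Field K] (n : ℕ) :
    graphDepth K (pathGraph n) = ((n + 2) / 3 : ℕ) := by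
  obtain ⟨ε, hε⟩ : ∃ ε, n % 3 = 1 ∧ ε = 0 ∨ n % 3 ≠ 1 ∧ ε = 1 := by
    by_cases h : n % 3 = 1 <;> simp [h]
  rw [← card_filter_val_mod_three hε]
  refine IsPerfectCode.graphDepth_eq_card K ?_
  rw [Finset.coe_filter_univ]
  exact isPerfectCode_pathGraph hε

end Path

theorem mainTheorem4 (n : ℕ) (hn : 2 ≤ n) (K : Type*) [Field K] (K' : Type*) [Field K'] :
    graphDepth K (SimpleGraph.pathGraph n) = graphDepth K' (SimpleGraph.pathGraph n) ∧
    (n ≡ 0 [MOD 3] → graphDepth K (SimpleGraph.pathGraph n) = ((n / 3 : ℕ) : ℕ∞)) ∧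
    (n ≡ 1 [MOD 3] → graphDepth K (SimpleGraph.pathGraph n) = (((n + 2) / 3 : ℕ) : ℕ∞)) ∧
    (n ≡ 2 [MOD 3] → graphDepth K (SimpleGraph.pathGraph n) = (((n + 1) / 3 : ℕ) : ℕ∞)) := by
  rw [graphDepth_pathGraph, graphDepth_pathGraph]
  refine ⟨rfl, fun h => ?_, fun _ => rfl, fun h => ?_⟩ <;>
    exact congrArg (Nat.cast : ℕ → ℕ∞) (by rw [Nat.ModEq] at h; omega)
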